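/- Consider deterministic Turing machines with finitely many states, one tape that is infinite to the right only, one read/write head (which may move left, move right or stay, and which stays in place on a left move from the leftmost cell), and two tape symbols: blank ($0$) and marked ($1$). Such a machine is *write-once* if it never writes a blank to a marked cell (marking a marked cell again is allowed). An input word $w\in\{0,1\}^*$ is written at the left end of an otherwise blank tape, each letter occupying two cells, with the letter $0$ represented by $10$ and the letter $1$ by $01$; the head starts on the leftmost cell. A machine decides a language $L\subseteq\{0,1\}^*$ if it halts on every input and halts in an accepting state exactly on the words of $L$. Its running time on $w$ is the number of steps, and its space on $w$ is the number of tape cells visited by the head. Let $\exp_0(m)=m$ and $\exp_{k+1}(m)=2^{\exp_k(m)}$. Let $k$-$\mathrm{ExpTime}$ be the class of languages $L\subseteq\{0,1\}^*$ that, for some $t\in\mathbb N$, are decided by a machine in time $O(\exp_k(n^t))$, where $n=|w|$, and let $k$-$\mathrm{DExpWOSpace}$ be the class of languages that, for some $t\in\mathbb N$, are decided by a write-once machine in space $O(\exp_k(n^t))$. **Theorem.** For every $k\in\mathbb N$, $$k\text{-}\mathrm{ExpTime} = k\text{-}\mathrm{DExpWOSpace}.$$ -/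

import Mathlib

namespace WOTM

/-- Head movements. -/
inductive Move where
  | left
  | stay
  | right

/-- The new head position. The tape is infinite to the right only: a move to the left on the
leftmost cell (cell `0`) leaves the head where it is. -/
def Move.apply : Move → ℕ → ℕ
  | Move.left, i => i - 1
  | Move.stay, i => i
  | Move.right, i => i + 1

/-- A deterministic Turing machine with finitely many states, one one-way infinite tape, one
read/write head, and the two tape symbols `false` (blank) and `true` (marked).
`δ q a = some (q', b, d)`: in state `q` reading `a`, write `b`, move the head by `d`, go to
state `q'`. `δ q a = none`: halt. -/
structure Machine where
  Q : Type
  [finQ : Finite Q]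
  start : Q
  accept : Set Q
  δ : Q → Bool → Option (Q × Bool × Move)

/-- A machine is write-once if it never writes a blank to a marked cell. (Marking a cell that
is already marked, or leaving a blank cell blank, is allowed.) -/
def Machine.IsWriteOnce (M : Machine) : Prop :=
  ∀ (q q' : M.Q) (b : Bool) (d : Move), M.δ q true = some (q', b, d) → b = true

/-- Configurations. -/
structure Cfg (M : Machine) where
  state : M.Q
  head : ℕ
  tape : ℕ → Bool

/-- One step of computation; `none` if the machine halts. -/
def Machine.step (M : Machine) (c : Cfg M) : Option (Cfg M) :=
  (M.δ c.state (c.tape c.head)).map fun r =>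
    { state := r.1
      head := r.2.2.apply c.head
      tape := Function.update c.tape c.head r.2.1 }

/-- The two cells that represent an input symbol: `0` is marked-blank, `1` is blank-marked.
(Two blank cells represent the absence of a symbol, two marked cells an erased symbol.) -/
def encodeBit : Bool → List Bool
  | false => [true, false]
  | true => [false, true]

/-- The initial tape: the encoded input word at the left end, followed by blanks. -/
def inputTape (w : List Bool) : ℕ → Bool :=
  fun i => (w.flatMap encodeBit).getD i false

/-- The initial configuration on input `w`. -/
def Machine.init (M : Machine) (w : List Bool) : Cfg M where
  state := M.start
  head := 0
  tape := inputTape w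

/-- The configuration after exactly `t` steps on input `w`; `none` if the machine halts after
fewer than `t` steps. -/
def Machine.run (M : Machine) (w : List Bool) : ℕ → Option (Cfg M)
  | 0 => some (M.init w)
  | t + 1 => (M.run w t).bind M.step

/-- `M` halts on every input, and halts in an accepting state exactly on the words of `L`. -/
def Machine.Decides (M : Machine) (L : Language Bool) : Prop :=
  ∀ w : List Bool, ∃ (t : ℕ) (c : Cfg M),
    M.run w t = some c ∧ M.step c = none ∧ (c.state ∈ M.accept ↔ w ∈ L)

/-- On every input `w`, `M` makes at most `f |w|` steps. -/
def Machine.RunsInTime (M : Machine) (f : ℕ → ℕ) : Prop :=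
  ∀ (w : List Bool) (t : ℕ) (c : Cfg M), M.run w t = some c → t ≤ f w.length

/-- On every input `w`, the head of `M` visits at most `f |w|` cells. (The visited cells always
form an initial segment of the tape.) -/
def Machine.RunsInSpace (M : Machine) (f : ℕ → ℕ) : Prop :=
  ∀ (w : List Bool) (t : ℕ) (c : Cfg M), M.run w t = some c → c.head < f w.length

/-- Languages decided by a (usual) deterministic machine in time `O(f)`. -/
def DTime (f : ℕ → ℕ) : Set (Language Bool) :=
  {L | ∃ (M : Machine) (C : ℕ), M.Decides L ∧ M.RunsInTime fun n => C * f n + C}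

/-- Languages decided by a deterministic write-once machine in space `O(f)`. -/
def DWOSpace (f : ℕ → ℕ) : Set (Language Bool) :=
  {L | ∃ (M : Machine) (C : ℕ), M.IsWriteOnce ∧ M.Decides L ∧
    M.RunsInSpace fun n => C * f n + C}

/-- The `k`-fold iterated exponential: `kexp 0 m = m`, `kexp (k + 1) m = 2 ^ kexp k m`. -/
def kexp : ℕ → ℕ → ℕ
  | 0, m => m
  | k + 1, m => 2 ^ kexp k m

/-- `k`-ExpTime. -/
def kExpTime (k : ℕ) : Set (Language Bool) :=
  ⋃ t : ℕ, DTime fun n => kexp k (n ^ t)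

/-- `k`-DExpWOSpace. -/
def kDExpWOSpace (k : ℕ) : Set (Language Bool) :=
  ⋃ t : ℕ, DWOSpace fun n => kexp k (n ^ t)

end WOTM

namespace WOTM

/-! ### Arithmetic of iterated exponentials -/

/-! Both inclusions cost at most a square, and squares are harmless: `kexp k (n ^ t) ^ 2` is `O(kexp
k (n ^ (2 * t + 1)))` (`exists_quadratic_kexp_le`).

From space to time, the write-once machine itself is fast. Marks only accumulate, so along one run
the number of marked cells determines the set of marked cells. A configuration in space `S` is thus
given by state, head position and a number at most `S`; a halting run repeats none, which leaves at
most `|Q| S (S + 1)` of them (`Machine.IsWriteOnce.runsInTime`).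

From time to space, a write-once tape serves as a queue of bits. Each bit occupies a pair of cells,
`10` or `01`; the front is removed by marking it to `11`, and new bits go into the blank pairs at
the end. The head finds the end as a blank pair and the front as the place after the last `11`
(`reach_queue_step`). The input is already such a queue; the blank pair after it is kept as a gap,
which tells the input from the output until it is consumed.

A queue suffices to simulate a Turing machine, because one step is a local rule on cells
(`Machine.cell_of_step`): a sweep reads the code of a configuration and appends the code of the next
one (`Machine.feeds_of_step`). In time `T` there are `O(T)` sweeps over `O(n + T)` cells, so `O((n +
T) ^ 2)` pairs are ever used (`Machine.reach_of_run`, `Machine.reach_of_halts`, `queueBound_le`). -/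

theorem kexp_mono (k : ℕ) : Monotone (kexp k) := by
  induction k with
  | zero => exact fun _ _ h => h
  | succ k ih => exact fun a b h => Nat.pow_le_pow_right (by norm_num) (ih h)

theorem le_kexp (k m : ℕ) : m ≤ kexp k m := by
  induction k with
  | zero => exact le_rfl
  | succ k ih => exact ih.trans Nat.lt_two_pow_self.le

theorem two_mul_le_two_pow_two_mul (m : ℕ) : 2 * 2 ^ m ≤ 2 ^ (2 * m) ∨ m = 0 := by
  rcases m.eq_zero_or_pos with h | h
  · exact Or.inr h
  · left
    rw [← pow_succ']
    exact Nat.pow_le_pow_right (by norm_num) (by omega)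

theorem two_mul_kexp_le (k : ℕ) {m : ℕ} (hm : 0 < m) : 2 * kexp k m ≤ kexp k (2 * m) := by
  induction k with
  | zero => exact le_rfl
  | succ k ih =>
    have hpos : 0 < kexp k m := hm.trans_le (le_kexp k m)
    calc 2 * 2 ^ kexp k m ≤ 2 ^ (2 * kexp k m) :=
          (two_mul_le_two_pow_two_mul _).resolve_right hpos.ne'
      _ ≤ 2 ^ kexp k (2 * m) := Nat.pow_le_pow_right (by norm_num) ih

/-- For `n ≥ 2`, squaring needs the exponent `2 * t` if `k = 0`. If `k > 0`, it doubles the top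
exponent, which is absorbed by `2 * n ^ t ≤ n ^ (t + 1)`. The exponent `2 * t + 1` covers both
cases, and the additive constant covers `n < 2`. -/
theorem kexp_sq_le (k t n : ℕ) :
    kexp k (n ^ t) ^ 2 ≤ kexp k (n ^ (2 * t + 1)) + kexp k 1 ^ 2 := by
  rcases Nat.lt_or_ge n 2 with hn | hn
  · refine le_add_left (Nat.pow_le_pow_left (kexp_mono k ?_) 2)
    calc n ^ t ≤ 1 ^ t := Nat.pow_le_pow_left (by omega) t
      _ = 1 := one_pow t
  · refine le_add_right ?_
    cases k with
    | zero =>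
      change (n ^ t) ^ 2 ≤ n ^ (2 * t + 1)
      rw [← pow_mul]
      exact Nat.pow_le_pow_right (by omega) (by omega)
    | succ k =>
      change (2 ^ kexp k (n ^ t)) ^ 2 ≤ 2 ^ kexp k (n ^ (2 * t + 1))
      rw [← pow_mul]
      refine Nat.pow_le_pow_right (by norm_num) ?_
      rw [mul_comm]
      refine (two_mul_kexp_le k (by positivity)).trans (kexp_mono k ?_)
      calc 2 * n ^ t ≤ n * n ^ t := Nat.mul_le_mul_right _ hn
        _ = n ^ (t + 1) := (pow_succ' n t).symm
        _ ≤ n ^ (2 * t + 1) := Nat.pow_le_pow_right (by omega) (by omega)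

/-- A quadratic polynomial in `kexp k (n ^ t)` is `O(kexp k (n ^ (2 * t + 1)))`. -/
theorem exists_quadratic_kexp_le (k t a b : ℕ) : ∃ C : ℕ, ∀ n : ℕ,
    a * kexp k (n ^ t) ^ 2 + b ≤ C * kexp k (n ^ (2 * t + 1)) + C := by
  refine ⟨a * (kexp k 1 ^ 2 + 1) + b, fun n => ?_⟩
  have h := Nat.mul_le_mul_left a (kexp_sq_le k t n)
  nlinarith [Nat.zero_le (kexp k (n ^ (2 * t + 1)) * (a * kexp k 1 ^ 2)),
    Nat.zero_le (kexp k (n ^ (2 * t + 1)) * b)]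

/-! ### Runs -/

theorem Machine.run_add (M : Machine) (w : List Bool) {i j : ℕ} (h : M.run w i = M.run w j)
    (s : ℕ) : M.run w (i + s) = M.run w (j + s) := by
  induction s with
  | zero => exact h
  | succ s ih => rw [← add_assoc, ← add_assoc, Machine.run, Machine.run, ih]

theorem Machine.run_succ_eq_some {M : Machine} {w : List Bool} {t : ℕ} {c : Cfg M}
    (h : M.run w (t + 1) = some c) : ∃ d, M.run w t = some d ∧ M.step d = some c :=
  Option.bind_eq_some_iff.1 h

theorem Machine.run_eq_some_of_le {M : Machine} {w : List Bool} {s t : ℕ} (hst : s ≤ t)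
    {c : Cfg M} (h : M.run w t = some c) : ∃ d, M.run w s = some d := by
  induction hst generalizing c with
  | refl => exact ⟨c, h⟩
  | step _ ih =>
    obtain ⟨d, hd, -⟩ := run_succ_eq_some h
    exact ih hd

theorem Machine.run_le_of_halts {M : Machine} {w : List Bool} {s t : ℕ} {c d : Cfg M}
    (ht : M.run w t = some c) (hc : M.step c = none) (hs : M.run w s = some d) : s ≤ t := by
  by_contra! h
  obtain ⟨e, he⟩ := run_eq_some_of_le (Nat.succ_le_of_lt h) hs
  obtain ⟨c', hc', he⟩ := run_succ_eq_some he
  rw [ht, Option.some.injEq] at hc'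
  rw [← hc', hc] at he
  cases he

/-- A halting run does not visit a configuration twice. -/
theorem Machine.run_injective_of_halts {M : Machine} {w : List Bool} {t : ℕ} {c : Cfg M}
    (ht : M.run w t = some c) (hc : M.step c = none) {i j : ℕ} {d : Cfg M}
    (hi : M.run w i = some d) (hj : M.run w j = some d) : i = j := by
  wlog hij : i ≤ j generalizing i j
  · exact (this hj hi (le_of_not_ge hij)).symm
  by_contra hne
  have hjt := run_le_of_halts ht hc hj
  -- If `i < j`, this time is at most `t`, so the run is defined there. By determinism it is then
  -- also defined at time `j + (t + 1 - j) = t + 1`, after the halt.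
  obtain ⟨e, he⟩ := run_eq_some_of_le (s := i + (t + 1 - j)) (by omega) ht
  rw [run_add M w (hi.trans hj.symm), Nat.add_sub_cancel' (by omega)] at he
  have := run_le_of_halts ht hc he
  omega

theorem Machine.step_eq_some {M : Machine} {c c' : Cfg M} (h : M.step c = some c') :
    ∃ r, M.δ c.state (c.tape c.head) = some r ∧
      c' = ⟨r.1, r.2.2.apply c.head, Function.update c.tape c.head r.2.1⟩ := by
  obtain ⟨r, hr, h⟩ := Option.map_eq_some_iff.1 h
  exact ⟨r, hr, h.symm⟩

theorem Machine.step_eq_none {M : Machine} {c : Cfg M} :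
    M.step c = none ↔ M.δ c.state (c.tape c.head) = none :=
  Option.map_eq_none_iff

/-! ### Write-once machines are fast -/

theorem Machine.IsWriteOnce.tape_mono {M : Machine} (hM : M.IsWriteOnce) {w : List Bool}
    {s t : ℕ} (hst : s ≤ t) {c d : Cfg M} (hs : M.run w s = some c) (ht : M.run w t = some d)
    {i : ℕ} (hi : c.tape i = true) : d.tape i = true := by
  induction hst generalizing d with
  | refl => rw [hs, Option.some.injEq] at ht; exact ht ▸ hi
  | step _ ih =>
    obtain ⟨e, he, hd⟩ := run_succ_eq_some ht
    obtain ⟨⟨q, b, m⟩, hr, rfl⟩ := step_eq_some hd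
    have hei := ih he
    by_cases h : i = e.head
    · subst h
      rw [hei] at hr
      simpa using hM _ _ _ _ hr
    · simpa [Function.update_of_ne h] using hei

/-- Cells that are never visited keep their content, so only the marks within the space bound need
to be counted. -/
theorem Machine.tape_eq_inputTape_of_space {M : Machine} {f : ℕ → ℕ} (hM : M.RunsInSpace f)
    {w : List Bool} {t : ℕ} {c : Cfg M} (h : M.run w t = some c) {i : ℕ}
    (hi : f w.length ≤ i) : c.tape i = inputTape w i := by
  induction t generalizing c with
  | zero =>
    rw [run, Option.some.injEq] at h
    rw [← h, init]
  | succ t ih =>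
    obtain ⟨d, hd, hc⟩ := run_succ_eq_some h
    obtain ⟨r, -, rfl⟩ := step_eq_some hc
    have := hM w t d hd
    rw [← ih hd]
    exact Function.update_of_ne (by omega) _ _

/-- A write-once decider that runs in space `f` makes at most `|Q| f (f + 1)` steps: a
configuration of its run is determined by state, head position and number of marked cells. -/
theorem Machine.IsWriteOnce.runsInTime {M : Machine} (hM : M.IsWriteOnce)
    {L : Language Bool} (hL : M.Decides L) {f : ℕ → ℕ} (hf : M.RunsInSpace f) :
    M.RunsInTime fun n => Nat.card M.Q * (f n * (f n + 1)) := by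
  classical
  intro w t c ht
  obtain ⟨T, e, hT, he, -⟩ := hL w
  have hfin := M.finQ
  have hrun : ∀ s : Fin (t + 1), ∃ d, M.run w s = some d := fun s =>
    run_eq_some_of_le (Nat.lt_succ_iff.1 s.2) ht
  choose d hd using hrun
  set S := f w.length
  let marks (s : Fin (t + 1)) : Finset ℕ := (Finset.range S).filter fun i => (d s).tape i = true
  have hmarks (s) : (marks s).card < S + 1 :=
    Nat.lt_succ_of_le ((Finset.card_filter_le _ _).trans_eq (Finset.card_range S))
  let g (s : Fin (t + 1)) : M.Q × Fin S × Fin (S + 1) :=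
    ((d s).state, ⟨(d s).head, hf w s _ (hd s)⟩, ⟨(marks s).card, hmarks s⟩)
  have key : ∀ i j : Fin (t + 1), i ≤ j → g i = g j → i = j := by
    intro i j hij hg
    simp only [g, Prod.mk.injEq, Fin.mk.injEq] at hg
    obtain ⟨h1, h2, h3⟩ := hg
    -- Marks are never removed, so the earlier set lies in the later one; equal cardinalities make
    -- them equal.
    have hsub : marks i ⊆ marks j := fun x hx => by
      simp only [marks, Finset.mem_filter] at hx ⊢
      exact ⟨hx.1, hM.tape_mono hij (hd i) (hd j) hx.2⟩
    have heq := Finset.eq_of_subset_of_card_le hsub h3.ge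
    have htape : (d i).tape = (d j).tape := by
      funext x
      by_cases hx : x < S
      · have := Finset.ext_iff.1 heq x
        simp only [marks, Finset.mem_filter, Finset.mem_range, hx, true_and] at this
        exact Bool.eq_iff_iff.2 this
      · rw [tape_eq_inputTape_of_space hf (hd i) (not_lt.1 hx),
          tape_eq_inputTape_of_space hf (hd j) (not_lt.1 hx)]
    have hcfg : d i = d j := by
      cases hi : d i; cases hj : d j
      simp_all
    exact Fin.ext (run_injective_of_halts hT he (hd i) (hcfg ▸ hd j))
  have hinj : Function.Injective g := fun i j hg =>
    (le_total i j).elim (fun h => key i j h hg) fun h => (key j i h hg.symm).symm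
  have := Nat.card_le_card_of_injective g hinj
  simp only [Nat.card_prod, Nat.card_fin] at this
  change t ≤ Nat.card M.Q * (S * (S + 1))
  omega

theorem kDExpWOSpace_subset_kExpTime (k : ℕ) : kDExpWOSpace k ⊆ kExpTime k := by
  intro L hL
  obtain ⟨t, M, C, hM, hL, hS⟩ := Set.mem_iUnion.1 hL
  -- With `S = C * E + C`, the product `S * (S + 1)` is at most `C * (C + 1) * (E + 1) ^ 2`, and `(E
  -- + 1) ^ 2 ≤ 4 * (E ^ 2 + 1)`.
  obtain ⟨C', hC'⟩ := exists_quadratic_kexp_le k t (Nat.card M.Q * (4 * (C * (C + 1))))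
    (Nat.card M.Q * (4 * (C * (C + 1))))
  refine Set.mem_iUnion.2 ⟨2 * t + 1, M, C', hL, fun w s c hs => ?_⟩
  refine (hM.runsInTime hL hS w s c hs).trans (le_trans ?_ (hC' w.length))
  beta_reduce
  rw [mul_assoc (Nat.card M.Q), ← mul_add]
  refine Nat.mul_le_mul_left _ ?_
  generalize kexp k (w.length ^ t) = E
  have hE : (E + 1) * (E + 1) ≤ 4 * (E ^ 2 + 1) := by nlinarith [sq_nonneg ((E : ℤ) - 1)]
  calc (C * E + C) * (C * E + C + 1) ≤ (C * (E + 1)) * ((C + 1) * (E + 1)) := by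
        apply Nat.mul_le_mul <;> nlinarith
    _ = C * (C + 1) * ((E + 1) * (E + 1)) := by ring
    _ ≤ C * (C + 1) * (4 * (E ^ 2 + 1)) := Nat.mul_le_mul_left _ hE
    _ = _ := by ring


/-! ### Reachability in bounded space -/

/-- `c'` is reached from `c`, with the head below `B` in all configurations before `c'`. -/
def Machine.Reach (M : Machine) (B : ℕ) : Cfg M → Cfg M → Prop :=
  Relation.ReflTransGen fun c c' => c.head < B ∧ M.step c = some c'

theorem Machine.Reach.trans {M : Machine} {B : ℕ} {c d e : Cfg M} (h : M.Reach B c d)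
    (h' : M.Reach B d e) : M.Reach B c e :=
  Relation.ReflTransGen.trans h h'

theorem Machine.Reach.head {M : Machine} {B : ℕ} {c d e : Cfg M} (hc : c.head < B)
    (h : M.step c = some d) (h' : M.Reach B d e) : M.Reach B c e :=
  Relation.ReflTransGen.head ⟨hc, h⟩ h'

theorem Machine.Reach.exists_run {M : Machine} {B : ℕ} {w : List Bool} {c : Cfg M}
    (h : M.Reach B (M.init w) c) : ∃ t, M.run w t = some c ∧
      ∀ s d, s < t → M.run w s = some d → d.head < B := by
  induction h with
  | refl => exact ⟨0, rfl, fun s d hs => absurd hs (Nat.not_lt_zero s)⟩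
  | @tail c e _ h ih =>
    obtain ⟨t, ht, hlt⟩ := ih
    refine ⟨t + 1, ?_, fun s d hs hd => ?_⟩
    · rw [Machine.run, ht]
      exact h.2
    · rcases Nat.lt_succ_iff_lt_or_eq.1 hs with hs | rfl
      · exact hlt s d hs hd
      · rw [ht, Option.some.injEq] at hd
        exact hd ▸ h.1

/-! ### Tapes as lists of pairs of cells -/

/-- The tape that holds the given pairs of cells, followed by blanks. -/
def tapeOf (l : List (Bool × Bool)) : ℕ → Bool :=
  fun i => (l.flatMap fun x => [x.1, x.2]).getD i false

theorem tapeOf_cons_add_two (x : Bool × Bool) (l : List (Bool × Bool)) (i : ℕ) :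
    tapeOf (x :: l) (i + 2) = tapeOf l i := rfl

theorem tapeOf_append (L R : List (Bool × Bool)) (i : ℕ) :
    tapeOf (L ++ R) (2 * L.length + i) = tapeOf R i := by
  induction L with
  | nil => simp
  | cons x L ih =>
    rw [List.length_cons, List.cons_append,
      show 2 * (L.length + 1) + i = 2 * L.length + i + 2 by ring, tapeOf_cons_add_two, ih]

theorem tapeOf_congr_append (L : List (Bool × Bool)) {R R' : List (Bool × Bool)}
    (h : tapeOf R = tapeOf R') : tapeOf (L ++ R) = tapeOf (L ++ R') := by
  induction L with
  | nil => exact h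
  | cons x L ih =>
    funext i
    match i with
    | 0 => rfl
    | 1 => rfl
    | i + 2 => exact congrFun ih i

/-- This exposes the blank pair behind the queue as a list entry, so that the step lemmas, which
need a pair under the head, apply at the end of the list. -/
theorem tapeOf_append_blank (L : List (Bool × Bool)) :
    tapeOf (L ++ [(false, false)]) = tapeOf L := by
  conv_rhs => rw [← List.append_nil L]
  refine tapeOf_congr_append L (funext fun i => ?_)
  match i with
  | 0 => rfl
  | 1 => rfl
  | i + 2 => rfl

theorem tapeOf_fst (L R : List (Bool × Bool)) (x : Bool × Bool) :
    tapeOf (L ++ x :: R) (2 * L.length) = x.1 :=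
  tapeOf_append L (x :: R) 0

theorem tapeOf_snd (L R : List (Bool × Bool)) (x : Bool × Bool) :
    tapeOf (L ++ x :: R) (2 * L.length + 1) = x.2 :=
  tapeOf_append L (x :: R) 1

theorem update_tapeOf_fst (L R : List (Bool × Bool)) (x : Bool × Bool) (b : Bool) :
    Function.update (tapeOf (L ++ x :: R)) (2 * L.length) b = tapeOf (L ++ (b, x.2) :: R) := by
  induction L with
  | nil =>
    funext i
    match i with
    | 0 => rfl
    | 1 => rfl
    | i + 2 => rfl
  | cons y L ih =>
    funext i
    match i with
    | 0 => rw [Function.update_of_ne (by simp)]; rfl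
    | 1 => rw [Function.update_of_ne (by simp; omega)]; rfl
    | i + 2 =>
      have := congrFun ih i
      simp only [List.length_cons, List.cons_append, tapeOf_cons_add_two,
        Function.update_apply] at this ⊢
      rw [← this]
      exact if_congr (by omega) rfl rfl

theorem update_tapeOf_snd (L R : List (Bool × Bool)) (x : Bool × Bool) (b : Bool) :
    Function.update (tapeOf (L ++ x :: R)) (2 * L.length + 1) b =
      tapeOf (L ++ (x.1, b) :: R) := by
  induction L with
  | nil =>
    funext i
    match i with
    | 0 => rfl
    | 1 => rfl
    | i + 2 => rfl
  | cons y L ih =>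
    funext i
    match i with
    | 0 => rw [Function.update_of_ne (by simp)]; rfl
    | 1 => rw [Function.update_of_ne (by simp)]; rfl
    | i + 2 =>
      have := congrFun ih i
      simp only [List.length_cons, List.cons_append, tapeOf_cons_add_two,
        Function.update_apply] at this ⊢
      rw [← this]
      exact if_congr (by omega) rfl rfl

/-- The pair of cells that represents a letter. -/
def letter (b : Bool) : Bool × Bool := (!b, b)

theorem inputTape_eq_tapeOf (w : List Bool) : inputTape w = tapeOf (w.map letter) := by
  funext i
  rw [inputTape, tapeOf, List.flatMap_map]
  congr 2
  funext b
  cases b <;> rfl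

/-! ### The write-once machine of a queue transducer -/

/-- Words of length at most `B`. -/
abbrev BList (B : ℕ) : Type := {l : List Bool // l.length ≤ B}

instance (B : ℕ) : Finite (BList B) := List.finite_length_le Bool B

/-- The states of the write-once machine of a queue transducer with states `Q`. The front of the
queue is the first pair of cells that is not erased. As long as input is left, a blank pair
separates the input from the output; `p` tells that this gap has been erased. -/
inductive QueueState (Q : Type) (B : ℕ) : Type
  | fetch (q : Q) (p : Bool)
  | fetchSnd (q : Q) (p a : Bool)
  | walk (q : Q) (p g : Bool) (w : BList B)
  | walkSnd (q : Q) (p g a : Bool) (w : BList B)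
  | put (q : Q) (p : Bool) (w : BList B)
  | putSnd (q : Q) (p b : Bool) (w : BList B)
  | back (q : Q) (p : Bool)
  | backFst (q : Q) (p b : Bool)
  | leave (q : Q) (p : Bool)

open QueueState

/-- All data of a state. -/
def QueueState.toTuple {Q : Type} {B : ℕ} :
    QueueState Q B → Fin 9 × Q × Bool × Bool × Bool × BList B
  | fetch q p => (0, q, p, false, false, ⟨[], Nat.zero_le _⟩)
  | fetchSnd q p a => (1, q, p, a, false, ⟨[], Nat.zero_le _⟩)
  | walk q p g w => (2, q, p, g, false, w)
  | walkSnd q p g a w => (3, q, p, g, a, w)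
  | put q p w => (4, q, p, false, false, w)
  | putSnd q p b w => (5, q, p, b, false, w)
  | back q p => (6, q, p, false, false, ⟨[], Nat.zero_le _⟩)
  | backFst q p b => (7, q, p, b, false, ⟨[], Nat.zero_le _⟩)
  | leave q p => (8, q, p, false, false, ⟨[], Nat.zero_le _⟩)

theorem QueueState.toTuple_injective {Q : Type} {B : ℕ} :
    Function.Injective (toTuple : QueueState Q B → _) := by
  intro s s' h
  cases s <;> cases s' <;> simp_all [toTuple]

instance {Q : Type} [Finite Q] {B : ℕ} : Finite (QueueState Q B) :=
  Finite.of_injective _ toTuple_injective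

/-- The letter that a pair of cells represents; a blank pair is the end of the input. -/
def readPair : Bool → Bool → Option (Option Bool)
  | true, false => some (some false)
  | false, true => some (some true)
  | false, false => some none
  | true, true => none

/-- The transitions of the write-once machine of a queue transducer. -/
def queueδ {Q : Type} (B : ℕ) (δ : Q → Option Bool → Option (Q × List Bool)) :
    QueueState Q B → Bool → Option (QueueState Q B × Bool × Move)
  | fetch q p, a => some (fetchSnd q p a, true, Move.right)
  | fetchSnd q p a, b => (readPair a b).bind fun x => (δ q x).map fun r =>
      (walk r.1 (p || x.isNone) (p || x.isNone) ⟨r.2.take B, List.length_take_le _ _⟩,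
        true, Move.right)
  | walk q p g w, a => some (walkSnd q p g a w, a, Move.right)
  | walkSnd q p g a w, b =>
      if a || b then some (walk q p g w, b, Move.right)
      else if g then some (put q p w, b, Move.left)
      else some (walk q p true w, b, Move.right)
  | put q p ⟨[], _⟩, a => some (back q p, a, Move.left)
  -- In the simulation the cell `a` is blank here. The disjunctions `a || !b` and `a || b` make the
  -- machine write-once on every tape.
  | put q p ⟨b :: w, h⟩, a =>
      some (putSnd q p b ⟨w, (Nat.le_succ _).trans h⟩, a || !b, Move.right)
  | putSnd q p b w, a => some (put q p w, a || b, Move.right)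
  | back q p, b => some (backFst q p b, b, Move.left)
  | backFst q p b, a =>
      if a && b then some (leave q p, a, Move.right) else some (back q p, a, Move.left)
  | leave q p, b => some (fetch q p, b, Move.right)

/-- The write-once machine that simulates the queue transducer `δ`, which removes a letter from
the front of the queue and appends a word (of length at most `B`) at its end. -/
def queueMachine {Q : Type} [Finite Q] (B : ℕ) (δ : Q → Option Bool → Option (Q × List Bool))
    (start : Q) (accept : Set Q) : Machine where
  Q := QueueState Q B
  start := fetch start false
  accept := {s | ∃ q ∈ accept, ∃ p a, s = fetchSnd q p a}
  δ := queueδ B δ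

theorem eq_true_of_queueδ_true {Q : Type} {B : ℕ}
    {δ : Q → Option Bool → Option (Q × List Bool)} {s s' : QueueState Q B} {b : Bool} {d : Move}
    (h : queueδ B δ s true = some (s', b, d)) : b = true := by
  rcases s with ⟨q, p⟩ | ⟨q, p, a⟩ | ⟨q, p, g, w⟩ | ⟨q, p, g, a, w⟩ | ⟨q, p, ⟨_ | ⟨x, w⟩, hw⟩⟩ |
    ⟨q, p, x, w⟩ | ⟨q, p⟩ | ⟨q, p, x⟩ | ⟨q, p⟩ <;> simp only [queueδ] at h
  case fetchSnd =>
    obtain ⟨x, -, h⟩ := Option.bind_eq_some_iff.1 h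
    obtain ⟨r, -, h⟩ := Option.map_eq_some_iff.1 h
    simp only [Prod.mk.injEq] at h
    exact h.2.1.symm
  all_goals first
    | (simp only [Option.some.injEq, Prod.mk.injEq] at h; simpa using h.2.1.symm)
    | (split_ifs at h <;> simp_all)

/-- Reading the word `u` and appending the outputs leads the transducer from `q` to `q'`, with
the total output `o`. -/
inductive Feeds {Q : Type} (δ : Q → Option Bool → Option (Q × List Bool)) :
    Q → List Bool → Q → List Bool → Prop
  | nil (q : Q) : Feeds δ q [] q []
  | cons {q q' q'' : Q} {b : Bool} {w u o : List Bool} (h : δ q (some b) = some (q', w))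
      (h' : Feeds δ q' u q'' o) : Feeds δ q (b :: u) q'' (w ++ o)

theorem Feeds.append {Q : Type} {δ : Q → Option Bool → Option (Q × List Bool)}
    {q q' q'' : Q} {u u' o o' : List Bool} (h : Feeds δ q u q' o)
    (h' : Feeds δ q' u' q'' o') : Feeds δ q (u ++ u') q'' (o ++ o') := by
  induction h with
  | nil => exact h'
  | cons h _ ih =>
    rw [List.append_assoc]
    exact .cons h (ih h')

variable {Q : Type} [Finite Q] {B : ℕ} {δ : Q → Option Bool → Option (Q × List Bool)}
  {start : Q} {accept : Set Q}

theorem queueMachine_isWriteOnce : (queueMachine B δ start accept).IsWriteOnce :=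
  fun _ _ _ _ h => eq_true_of_queueδ_true h

/-- The configuration in state `s` with the pairs `L` to the left of the head and the pairs `R`
from the head on, the head being on the first cell of its pair. -/
def pairCfg (δ : Q → Option Bool → Option (Q × List Bool)) (start : Q) (accept : Set Q)
    (s : QueueState Q B) (L R : List (Bool × Bool)) : Cfg (queueMachine B δ start accept) :=
  ⟨s, 2 * L.length, tapeOf (L ++ R)⟩

/-- As `pairCfg`, with the head on the second cell of its pair. -/
def pairCfgSnd (δ : Q → Option Bool → Option (Q × List Bool)) (start : Q) (accept : Set Q)
    (s : QueueState Q B) (L R : List (Bool × Bool)) : Cfg (queueMachine B δ start accept) :=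
  ⟨s, 2 * L.length + 1, tapeOf (L ++ R)⟩

theorem step_fst_right {s s' : QueueState Q B} {L R : List (Bool × Bool)} {x : Bool × Bool}
    {b : Bool} (h : queueδ B δ s x.1 = some (s', b, Move.right)) :
    (queueMachine B δ start accept).step (pairCfg δ start accept s L (x :: R)) =
      some (pairCfgSnd δ start accept s' L ((b, x.2) :: R)) := by
  simp only [Machine.step, pairCfg, tapeOf_fst, queueMachine, h, Option.map_some, Move.apply,
    update_tapeOf_fst, pairCfgSnd]

theorem step_snd_right {s s' : QueueState Q B} {L R : List (Bool × Bool)} {x : Bool × Bool}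
    {b : Bool} (h : queueδ B δ s x.2 = some (s', b, Move.right)) :
    (queueMachine B δ start accept).step (pairCfgSnd δ start accept s L (x :: R)) =
      some (pairCfg δ start accept s' (L ++ [(x.1, b)]) R) := by
  simp only [Machine.step, pairCfg, tapeOf_snd, queueMachine, h, Option.map_some, Move.apply,
    update_tapeOf_snd, pairCfgSnd, List.length_append, List.length_singleton,
    List.append_assoc, List.singleton_append]
  rfl

theorem step_snd_left {s s' : QueueState Q B} {L R : List (Bool × Bool)} {x : Bool × Bool}
    {b : Bool} (h : queueδ B δ s x.2 = some (s', b, Move.left)) :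
    (queueMachine B δ start accept).step (pairCfgSnd δ start accept s L (x :: R)) =
      some (pairCfg δ start accept s' L ((x.1, b) :: R)) := by
  simp only [Machine.step, pairCfg, tapeOf_snd, queueMachine, h, Option.map_some, Move.apply,
    update_tapeOf_snd, pairCfgSnd, Nat.add_sub_cancel]

theorem step_fst_left {s s' : QueueState Q B} {L R : List (Bool × Bool)} {x : Bool × Bool}
    {b : Bool} (h : queueδ B δ s x.1 = some (s', b, Move.left)) :
    (queueMachine B δ start accept).step (pairCfg δ start accept s L (x :: R)) =
      some ⟨s', 2 * L.length - 1, tapeOf (L ++ (b, x.2) :: R)⟩ := by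
  simp only [Machine.step, pairCfg, tapeOf_fst, queueMachine, h, Option.map_some, Move.apply,
    update_tapeOf_fst]

theorem pairCfg_append_blank (s : QueueState Q B) (L R : List (Bool × Bool)) :
    pairCfg δ start accept s L (R ++ [(false, false)]) = pairCfg δ start accept s L R := by
  rw [pairCfg, pairCfg, ← List.append_assoc, tapeOf_append_blank]

variable {S : ℕ}

theorem reach_walk_of_ne_blank {q : Q} {p g : Bool} {w : BList B} {x : Bool × Bool}
    (hx : (x.1 || x.2) = true) (L R : List (Bool × Bool)) (hS : 2 * L.length + 1 < S) :
    (queueMachine B δ start accept).Reach S (pairCfg δ start accept (walk q p g w) L (x :: R))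
      (pairCfg δ start accept (walk q p g w) (L ++ [x]) R) :=
  .head (Nat.lt_of_succ_lt hS) (step_fst_right rfl) <|
    .head hS (step_snd_right (by simp only [queueδ, hx, if_true])) .refl

theorem reach_walk {q : Q} {p g : Bool} {w : BList B} (U : List (Bool × Bool))
    (hU : ∀ x ∈ U, (x.1 || x.2) = true) (L R : List (Bool × Bool))
    (hS : 2 * (L.length + U.length) < S) :
    (queueMachine B δ start accept).Reach S (pairCfg δ start accept (walk q p g w) L (U ++ R))
      (pairCfg δ start accept (walk q p g w) (L ++ U) R) := by
  induction U generalizing L with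
  | nil => rw [List.append_nil]; exact .refl
  | cons x U ih =>
    rw [List.length_cons] at hS
    refine (reach_walk_of_ne_blank (hU x (by simp)) L (U ++ R) (by omega)).trans ?_
    have := ih (fun y hy => hU y (by simp [hy])) (L ++ [x]) (by simp; omega)
    rwa [List.append_assoc] at this

/-- Whether the gap is passed on the way to the end of the queue. -/
def IsTail : Bool → List (Bool × Bool) → Prop
  | true, R => ∃ v : List Bool, R = v.map letter
  | false, R => ∃ u v : List Bool, R = u.map letter ++ (false, false) :: v.map letter

theorem or_of_mem_map_letter {v : List Bool} {x : Bool × Bool} (hx : x ∈ v.map letter) :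
    (x.1 || x.2) = true := by
  obtain ⟨b, -, rfl⟩ := List.mem_map.1 hx
  cases b <;> rfl

theorem and_of_mem_map_letter {v : List Bool} {x : Bool × Bool} (hx : x ∈ v.map letter) :
    (x.1 && x.2) = false := by
  obtain ⟨b, -, rfl⟩ := List.mem_map.1 hx
  cases b <;> rfl

theorem IsTail.append {p : Bool} {R : List (Bool × Bool)} (h : IsTail p R) (w : List Bool) :
    IsTail p (R ++ w.map letter) := by
  cases p
  · obtain ⟨u, v, rfl⟩ := h
    exact ⟨u, v ++ w, by simp⟩
  · obtain ⟨v, rfl⟩ := h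
    exact ⟨v ++ w, by simp⟩

theorem IsTail.prepend {p : Bool} {R : List (Bool × Bool)} (h : IsTail p R) (w : List Bool) :
    IsTail p (w.map letter ++ R) := by
  cases p
  · obtain ⟨u, v, rfl⟩ := h
    exact ⟨w ++ u, v, by simp⟩
  · obtain ⟨v, rfl⟩ := h
    exact ⟨w ++ v, by simp⟩

theorem IsTail.and_eq_false {p : Bool} {R : List (Bool × Bool)} (h : IsTail p R)
    {x : Bool × Bool} (hx : x ∈ R) : (x.1 && x.2) = false := by
  cases p
  · obtain ⟨u, v, rfl⟩ := h
    rcases List.mem_append.1 hx with hx | hx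
    · exact and_of_mem_map_letter hx
    · rcases List.mem_cons.1 hx with rfl | hx
      · rfl
      · exact and_of_mem_map_letter hx
  · obtain ⟨v, rfl⟩ := h
    exact and_of_mem_map_letter hx

theorem reach_walk_to_end {q : Q} {p g : Bool} {w : BList B} {R : List (Bool × Bool)}
    (hR : IsTail g R) (L : List (Bool × Bool)) (hS : 2 * (L.length + R.length) + 1 < S) :
    (queueMachine B δ start accept).Reach S (pairCfg δ start accept (walk q p g w) L R)
      (pairCfg δ start accept (put q p w) (L ++ R) []) := by
  have key (v : List Bool) (L : List (Bool × Bool))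
      (hS : 2 * (L.length + v.length) + 1 < S) : (queueMachine B δ start accept).Reach S
      (pairCfg δ start accept (walk q p true w) L (v.map letter))
      (pairCfg δ start accept (put q p w) (L ++ v.map letter) []) := by
    -- The blank pair at which the walk ends is made explicit on both sides.
    rw [← pairCfg_append_blank, ← pairCfg_append_blank _ _ []]
    refine (reach_walk _ (fun x => or_of_mem_map_letter) L _ ?_).trans ?_
    · simp; omega
    · refine .head ?_ (step_fst_right rfl) <| .head ?_ (step_snd_left rfl) .refl <;>
        simp [pairCfg, pairCfgSnd] <;> omega
  cases g
  · obtain ⟨u, v, rfl⟩ := hR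
    simp only [List.length_append, List.length_map, List.length_cons] at hS
    refine (reach_walk _ (fun x => or_of_mem_map_letter) L _ ?_).trans ?_
    · simp; omega
    -- The blank pair met while `g` is `false` is the gap; passing it sets `g`, so the next blank
    -- pair is the end of the queue.
    · have := key v (L ++ u.map letter ++ [(false, false)]) (by simp; omega)
      rw [show L ++ (u.map letter ++ (false, false) :: v.map letter) =
        L ++ u.map letter ++ [(false, false)] ++ v.map letter by simp]
      refine .head ?_ (step_fst_right rfl) <| .head ?_ (step_snd_right rfl) this <;>
        simp [pairCfg, pairCfgSnd] <;> omega
  · obtain ⟨v, rfl⟩ := hR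
    exact key v L (by simpa using hS)

theorem reach_put {q : Q} {p : Bool} (w : List Bool) (hw : w.length ≤ B)
    (L : List (Bool × Bool)) (hS : 2 * (L.length + w.length) < S) :
    (queueMachine B δ start accept).Reach S (pairCfg δ start accept (put q p ⟨w, hw⟩) L [])
      (pairCfg δ start accept (put q p ⟨[], Nat.zero_le _⟩) (L ++ w.map letter) []) := by
  induction w generalizing L with
  | nil => rw [List.map_nil, List.append_nil]; exact .refl
  | cons b w ih =>
    rw [List.length_cons] at hS
    have := ih ((Nat.le_succ _).trans hw) (L ++ [letter b]) (by simp; omega)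
    rw [List.append_assoc, List.singleton_append, ← List.map_cons] at this
    rw [← pairCfg_append_blank]
    refine .head ?_ (step_fst_right rfl) <| .head ?_ (step_snd_right rfl) this <;>
      simp [pairCfg, pairCfgSnd] <;> omega

/-- No pair of `U` is `11`, so the first such pair met on the way left is the last erased one. The
head starts on the second cell of the last pair of `(true, true) :: U`; the induction peels `U` from
the right, as the head does, and moves the passed pairs to `R`. -/
theorem reach_back {q : Q} {p : Bool} (U : List (Bool × Bool))
    (hU : ∀ x ∈ U, (x.1 && x.2) = false) (L R : List (Bool × Bool))
    (hS : 2 * (L.length + U.length) + 1 < S) :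
    (queueMachine B δ start accept).Reach S
      ⟨back q p, 2 * (L.length + U.length) + 1, tapeOf (L ++ (true, true) :: (U ++ R))⟩
      (pairCfg δ start accept (fetch q p) (L ++ [(true, true)]) (U ++ R)) := by
  induction U using List.reverseRecOn generalizing R with
  | nil =>
    refine .head (d := pairCfg δ start accept (backFst q p true) L ((true, true) :: R)) ?_
      (step_snd_left rfl) <| .head ?_ (step_fst_right rfl) <| .head ?_ (step_snd_right rfl) .refl <;>
      simp [pairCfg, pairCfgSnd] at hS ⊢ <;> omega
  | append_singleton U x ih =>
    simp only [List.length_append, List.length_singleton] at hS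
    have := ih (fun y hy => hU y (by simp [hy])) (x :: R) (by omega)
    have hx := hU x (by simp)
    have e : (⟨back q p, 2 * (L.length + (U ++ [x]).length) + 1,
        tapeOf (L ++ (true, true) :: (U ++ [x] ++ R))⟩ : Cfg (queueMachine B δ start accept)) =
        pairCfgSnd δ start accept (back q p) (L ++ (true, true) :: U) (x :: R) := by
      simp [pairCfgSnd]
    rw [e, List.append_assoc, List.singleton_append]
    refine .head ?_ (step_snd_left rfl) <| .head ?_ (step_fst_left (s' := back q p) (b := x.1) ?_) ?_
    · simp [pairCfgSnd]; omega
    · simp [pairCfg]; omega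
    · simp [queueδ, hx]
    · convert this using 2
      · simp; omega
      · simp

/-- One step of the queue transducer: the letter `x` is removed and the word `w` appended. -/
theorem reach_queue_step {q q' : Q} {p : Bool} {x : Bool × Bool} {o : Option Bool}
    {w : List Bool} {R : List (Bool × Bool)} (hx : readPair x.1 x.2 = some o)
    (hδ : δ q o = some (q', w)) (hw : w.length ≤ B) (hR : IsTail (p || o.isNone) R) (e : ℕ)
    (hS : 2 * (e + 1 + R.length + w.length) + 1 < S) :
    (queueMachine B δ start accept).Reach S
      (pairCfg δ start accept (fetch q p) (List.replicate e (true, true)) (x :: R))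
      (pairCfg δ start accept (fetch q' (p || o.isNone)) (List.replicate (e + 1) (true, true))
        (R ++ w.map letter)) := by
  have h : queueδ B δ (fetchSnd q p x.1) x.2 =
      some (walk q' (p || o.isNone) (p || o.isNone) ⟨w, hw⟩, true, Move.right) := by
    simp [queueδ, hx, hδ, List.take_of_length_le hw]
  have h1 := reach_walk_to_end (B := B) (δ := δ) (start := start) (accept := accept) (q := q')
    (p := p || o.isNone) (w := ⟨w, hw⟩) (S := S) hR (List.replicate (e + 1) (true, true))
    (by simp; omega)
  have h2 := reach_put (δ := δ) (start := start) (accept := accept) (q := q')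
    (p := p || o.isNone) w hw (S := S) (List.replicate (e + 1) (true, true) ++ R)
    (by simp; omega)
  -- The pair just erased by `fetch` is where the way back ends, so it exists even for `e = 0`. The
  -- extra blank pair is the one on which `put` finishes.
  have h3 := reach_back (B := B) (δ := δ) (start := start) (accept := accept) (q := q')
    (p := p || o.isNone) (R ++ w.map letter) (fun x hx => (hR.append w).and_eq_false hx) (S := S)
    (List.replicate e (true, true)) [(false, false)]
    (by simp; omega)
  rw [← List.replicate_succ', pairCfg_append_blank] at h3
  refine .head ?_ (step_fst_right rfl) <| .head ?_ (step_snd_right h) ?_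
  · simp [pairCfg]; omega
  · simp [pairCfgSnd]; omega
  · rw [← List.replicate_succ']
    refine (h1.trans h2).trans ?_
    rw [← pairCfg_append_blank]
    refine .head ?_ (step_fst_left rfl) ?_
    · simp [pairCfg]; omega
    · convert h3 using 2
      · simp; omega
      · rw [List.replicate_succ']; simp

/-- Each queue step turns one pair of `u` into an erased pair and moves its output from `o` to `R`,
so the sum in the space hypothesis is invariant. Only letters are read, never the gap, so `p` does
not change. -/
theorem reach_of_feeds (hB : ∀ q o q' w, δ q o = some (q', w) → w.length ≤ B) {q q' : Q}
    {p : Bool} {u o : List Bool} (h : Feeds δ q u q' o) {R : List (Bool × Bool)}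
    (hR : IsTail p R) (e : ℕ) (hS : 2 * (e + u.length + R.length + o.length) + 1 < S) :
    (queueMachine B δ start accept).Reach S
      (pairCfg δ start accept (fetch q p) (List.replicate e (true, true))
        (u.map letter ++ R))
      (pairCfg δ start accept (fetch q' p) (List.replicate (e + u.length) (true, true))
        (R ++ o.map letter)) := by
  induction h generalizing e R with
  | nil => rw [List.map_nil, List.append_nil]; exact .refl
  | @cons q q' q'' b w u o h _ ih =>
    simp only [List.length_cons, List.length_append] at hS
    have h1 := reach_queue_step (start := start) (accept := accept) (p := p)
      (x := letter b) (by cases b <;> rfl) h (hB _ _ _ _ h) (R := u.map letter ++ R) (S := S)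
      (by simpa using hR.prepend u) e (by simp; omega)
    have h2 := ih (hR.append w) (e + 1) (by simp; omega)
    rw [Option.isNone_some, Bool.or_false, List.append_assoc] at h1
    refine h1.trans ?_
    rw [List.append_assoc, ← List.map_append, Nat.add_assoc, Nat.add_comm 1] at h2
    exact h2

end WOTM

namespace WOTM
open QueueState

/-! ### Turing machines as cellular automata -/

/-- The content of a cell, together with the state if the head is on this cell. -/
abbrev Machine.Cell (M : Machine) : Type := Bool × Option M.Q

/-- What a machine does on a cell; `none` if the head is elsewhere or the machine halts. -/
def Machine.act (M : Machine) (x : M.Cell) : Option (M.Q × Bool × Move) :=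
  x.2.bind fun q => M.δ q x.1

/-- The new state, if the head moves from the cell to the left. -/
def Machine.goLeft (M : Machine) (x : M.Cell) : Option M.Q :=
  (M.act x).bind fun r => match r.2.2 with | Move.left => some r.1 | _ => none

/-- The new state, if the head stays on the cell. -/
def Machine.goStay (M : Machine) (x : M.Cell) : Option M.Q :=
  (M.act x).bind fun r => match r.2.2 with | Move.stay => some r.1 | _ => none

/-- The new state, if the head moves from the cell to the right. -/
def Machine.goRight (M : Machine) (x : M.Cell) : Option M.Q :=
  (M.act x).bind fun r => match r.2.2 with | Move.right => some r.1 | _ => none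

/-- The local rule: the new cell from the left neighbour (`none` for the leftmost cell), the cell
and the right neighbour. -/
def Machine.rule (M : Machine) (l : Option M.Cell) (x r : M.Cell) : M.Cell :=
  (((M.act x).map fun a => a.2.1).getD x.1,
    (l.bind M.goRight).or ((M.goStay x).or
      ((if l.isNone then M.goLeft x else none).or (M.goLeft r))))

/-- The cells of a configuration. -/
def Cfg.cell {M : Machine} (c : Cfg M) (i : ℕ) : M.Cell :=
  (c.tape i, if c.head = i then some c.state else none)

/-- The left neighbour of a cell of a configuration. -/
def Cfg.leftCell {M : Machine} (c : Cfg M) : ℕ → Option M.Cell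
  | 0 => none
  | i + 1 => some (c.cell i)

/-- The cells after application of the local rule. -/
def Cfg.newCell {M : Machine} (c : Cfg M) (i : ℕ) : M.Cell :=
  M.rule (c.leftCell i) (c.cell i) (c.cell (i + 1))

theorem Machine.act_cell {M : Machine} (c : Cfg M) (i : ℕ) :
    M.act (c.cell i) = if c.head = i then M.δ c.state (c.tape c.head) else none := by
  by_cases h : c.head = i
  · subst h; simp [act, Cfg.cell]
  · simp [act, Cfg.cell, h]

/-- The head can reach a cell only from the left neighbour, from the right neighbour, by staying, or
by a left move on the leftmost cell. As there is one head, at most one of the alternatives in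
`Machine.rule` applies. -/
theorem Machine.cell_of_step {M : Machine} {c c' : Cfg M} (h : M.step c = some c') (i : ℕ) :
    c'.cell i = c.newCell i := by
  obtain ⟨⟨q, b, d⟩, hr, rfl⟩ := step_eq_some h
  have hact (j) := act_cell c j
  rw [hr] at hact
  refine Prod.ext ?_ ?_
  · by_cases hi : c.head = i
    · subst hi
      simp only [Cfg.newCell, rule, hact]
      simp [Cfg.cell]
    · simp only [Cfg.newCell, rule, hact]
      simp [hi, Cfg.cell, Function.update_of_ne (Ne.symm hi)]
  · rcases i with _ | i <;> rcases d with _ | _ | _ <;>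
      simp only [Cfg.newCell, rule, goLeft, goRight, goStay, hact, Cfg.leftCell, Move.apply,
        Option.bind_some, Option.bind_none] <;>
      simp only [Cfg.cell] <;>
      split_ifs <;> first | rfl | omega | simp_all

/-! ### The queue transducer of a Turing machine -/

/-- The letters on the queue: cells, and an end marker. -/
abbrev Machine.Letter (M : Machine) : Type := Option M.Cell

instance (M : Machine) : Finite M.Q := M.finQ

/-- The index of a letter. -/
noncomputable def Machine.index (M : Machine) : M.Letter ≃ Fin (Nat.card M.Letter) :=
  Finite.equivFin _

/-- Letters are represented in unary, with an end mark. -/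
noncomputable def Machine.encode (M : Machine) (x : M.Letter) : List Bool :=
  List.replicate (M.index x) false ++ [true]

theorem Machine.length_encode_le (M : Machine) (x : M.Letter) :
    (M.encode x).length ≤ Nat.card M.Letter := by
  simpa only [encode, List.length_append, List.length_replicate, List.length_singleton]
    using Nat.succ_le_of_lt (M.index x).2

theorem Machine.length_flatMap_encode_le (M : Machine) (l : List M.Letter) :
    (l.flatMap M.encode).length ≤ Nat.card M.Letter * l.length := by
  induction l with
  | nil => simp
  | cons x l ih =>
    have := M.length_encode_le x
    simp only [List.flatMap_cons, List.length_append, List.length_cons, mul_add_one]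
    omega

/-- The states of the queue transducer of `M`: first, the input is replaced by cells. Then each
step of `M` is a sweep through the queue; in `sweep (some (l, x)) j`, the cell `x` and its left
neighbour `l` have been read, and `j` bits of the next letter. -/
inductive SweepState (M : Machine) : Type
  | load (isFirst : Bool)
  | sweep (s : Option (Option M.Cell × M.Cell)) (j : Fin (Nat.card M.Letter))
  | done (isAccepted : Bool)

open SweepState

/-- All data of a state. -/
def SweepState.toSum {M : Machine} : SweepState M →
    Bool ⊕ (Option (Option M.Cell × M.Cell) × Fin (Nat.card M.Letter)) ⊕ Bool
  | load f => .inl f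
  | sweep s j => .inr (.inl (s, j))
  | done a => .inr (.inr a)

theorem SweepState.toSum_injective {M : Machine} :
    Function.Injective (toSum : SweepState M → _) := by
  intro s s' h
  cases s <;> cases s' <;> simp_all [toSum]

instance {M : Machine} : Finite (SweepState M) :=
  Finite.of_injective _ SweepState.toSum_injective

/-- The head is on this cell and the machine halts. -/
def Machine.IsHalting (M : Machine) (x : M.Cell) : Prop :=
  x.2 ≠ none ∧ M.act x = none

/-- The state at the beginning of a letter. -/
noncomputable def Machine.sweepStart (M : Machine) (s : Option (Option M.Cell × M.Cell)) :
    SweepState M :=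
  sweep s ⟨0, Nat.card_pos⟩

open Classical in
/-- The new state after the cell `x`, whose left neighbour is `l`, is read. -/
noncomputable def Machine.afterCell (M : Machine) (l : Option M.Cell) (x : M.Cell) :
    SweepState M :=
  if M.IsHalting x then done (decide (∃ q ∈ M.accept, x.2 = some q))
  else M.sweepStart (some (l, x))

/-- The blank cell, away from the head. -/
def Machine.blank (M : Machine) : M.Cell := (false, none)

/-- A step of the sweep: the new state and the new letters when a letter is read. At each sweep,
a blank cell is added. -/
noncomputable def Machine.sweepStep (M : Machine) :
    Option (Option M.Cell × M.Cell) → M.Letter → SweepState M × List M.Letter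
  | none, some y => (M.afterCell none y, [])
  -- The output lags one cell behind the input, since the new value of `x` depends on its right
  -- neighbour `y`. At the end marker the missing neighbours are blank.
  | some (l, x), some y => (M.afterCell (some x) y, [some (M.rule l x y)])
  | none, none => (M.sweepStart none, [none])
  | some (l, x), none => (M.sweepStart none,
      [some (M.rule l x M.blank), some (M.rule (some x) M.blank M.blank), none])

/-- The queue transducer of a machine. -/
noncomputable def Machine.sweepδ (M : Machine) :
    SweepState M → Option Bool → Option (SweepState M × List Bool)
  | load f, some b => some (load false, [some (!b, if f then some M.start else none),
      some (b, none)].flatMap M.encode)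
  -- At the gap one blank cell is added; for the empty input it is the cell that carries the head.
  | load f, none => some (M.sweepStart none, [some (false, if f then some M.start else none),
      none].flatMap M.encode)
  -- The value `else j` is a default: in a code word the number of `false` is an index, so the
  -- counter never overflows.
  | sweep s j, some false =>
      some (sweep s (if h : j + 1 < Nat.card M.Letter then ⟨j + 1, h⟩ else j), [])
  | sweep s j, some true => some ((M.sweepStep s (M.index.symm j)).1,
      (M.sweepStep s (M.index.symm j)).2.flatMap M.encode)
  | sweep _ _, none => none
  | done _, _ => none

/-- The longest output is at the end marker: the last cell, the added cell and the marker. -/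
theorem Machine.length_le_of_sweepδ {M : Machine} {s s' : SweepState M} {o : Option Bool}
    {w : List Bool} (h : M.sweepδ s o = some (s', w)) : w.length ≤ Nat.card M.Letter * 3 := by
  have key (l : List M.Letter) (hl : l.length ≤ 3) :
      (l.flatMap M.encode).length ≤ Nat.card M.Letter * 3 :=
    (M.length_flatMap_encode_le l).trans (Nat.mul_le_mul_left _ hl)
  rcases s with f | ⟨s, j⟩ | a <;> rcases o with _ | _ | _ <;>
    simp only [sweepδ, Option.some.injEq, Prod.mk.injEq, reduceCtorEq] at h <;>
    obtain ⟨-, rfl⟩ := h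
  · exact key _ (by simp)
  · exact key _ (by simp)
  · exact key _ (by simp)
  · simp
  · refine key _ ?_
    generalize M.index.symm j = x
    rcases s with _ | ⟨l, y⟩ <;> rcases x with _ | x <;> simp [sweepStep]

theorem Machine.feeds_encode_aux (M : Machine) (s : Option (Option M.Cell × M.Cell))
    (x : M.Letter) (k i : ℕ) (hi : i < Nat.card M.Letter) (h : i + k = M.index x) :
    Feeds M.sweepδ (sweep s ⟨i, hi⟩) (List.replicate k false ++ [true]) (M.sweepStep s x).1
      ((M.sweepStep s x).2.flatMap M.encode) := by
  induction k generalizing i with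
  | zero =>
    have hx : M.index.symm ⟨i, hi⟩ = x := by
      rw [Equiv.symm_apply_eq]
      exact Fin.ext h
    rw [← List.append_nil (List.flatMap _ _)]
    refine .cons ?_ (.nil _)
    rw [sweepδ, hx]
  | succ k ih =>
    have hlt : i + 1 < Nat.card M.Letter := by have := (M.index x).2; omega
    have := ih (i + 1) hlt (by omega)
    rw [List.replicate_succ, List.cons_append,
      ← List.nil_append (List.flatMap _ (M.sweepStep s x).2)]
    refine .cons ?_ this
    rw [sweepδ, dif_pos hlt]

theorem Machine.feeds_encode (M : Machine) (s : Option (Option M.Cell × M.Cell))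
    (x : M.Letter) : Feeds M.sweepδ (M.sweepStart s) (M.encode x) (M.sweepStep s x).1
      ((M.sweepStep s x).2.flatMap M.encode) :=
  M.feeds_encode_aux s x _ 0 _ (Nat.zero_add _)

/-- The code of the first `L` cells of a configuration. -/
noncomputable def Cfg.code {M : Machine} (c : Cfg M) (L : ℕ) : List Bool :=
  ((List.range L).map fun i => some (c.cell i)).flatMap M.encode

theorem Cfg.code_succ {M : Machine} (c : Cfg M) (L : ℕ) :
    c.code (L + 1) = c.code L ++ M.encode (some (c.cell L)) := by
  simp [code, List.range_succ]

theorem Cfg.code_add {M : Machine} (c : Cfg M) (L k : ℕ) : ∃ v, c.code (L + k) = c.code L ++ v := by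
  induction k with
  | zero => exact ⟨[], by simp⟩
  | succ k ih =>
    obtain ⟨v, hv⟩ := ih
    exact ⟨v ++ M.encode (some (c.cell (L + k))), by rw [← add_assoc, code_succ, hv,
      List.append_assoc]⟩

theorem Cfg.length_code_le {M : Machine} (c : Cfg M) (L : ℕ) :
    (c.code L).length ≤ Nat.card M.Letter * L :=
  (M.length_flatMap_encode_le _).trans (by simp)

/-- The code of the first `L` cells of a configuration after application of the local rule. -/
noncomputable def Cfg.newCode {M : Machine} (c : Cfg M) (L : ℕ) : List Bool :=
  ((List.range L).map fun i => some (c.newCell i)).flatMap M.encode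

theorem Cfg.newCode_succ {M : Machine} (c : Cfg M) (L : ℕ) :
    c.newCode (L + 1) = c.newCode L ++ M.encode (some (c.newCell L)) := by
  simp [newCode, List.range_succ]

theorem Cfg.length_newCode_le {M : Machine} (c : Cfg M) (L : ℕ) :
    (c.newCode L).length ≤ Nat.card M.Letter * L :=
  (M.length_flatMap_encode_le _).trans (by simp)

/-- Because of the lag, `i + 1` cells are read while `i` are written. The hypothesis keeps the sweep
from stopping before cell `i`; the last state may be `done`, which serves both the halting and the
non-halting sweep. -/
theorem Machine.feeds_cell {M : Machine} (c : Cfg M) {i : ℕ}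
    (h : ∀ j < i, ¬ M.IsHalting (c.cell j)) :
    Feeds M.sweepδ (M.sweepStart none) (c.code (i + 1)) (M.afterCell (c.leftCell i) (c.cell i))
      (c.newCode i) := by
  induction i with
  | zero =>
    have h0 : c.code 1 = M.encode (some (c.cell 0)) := by simp [Cfg.code]
    rw [h0]
    exact M.feeds_encode none (some (c.cell 0))
  | succ i ih =>
    have := ih fun j hj => h j (hj.trans (Nat.lt_succ_self i))
    rw [afterCell, if_neg (h i (Nat.lt_succ_self i))] at this
    have h' := this.append (M.feeds_encode _ (some (c.cell (i + 1))))
    rw [← Cfg.code_succ] at h'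
    have e : c.newCode (i + 1) = c.newCode i ++ (M.sweepStep (some (c.leftCell i, c.cell i))
        (some (c.cell (i + 1)))).2.flatMap M.encode := by
      simp [Cfg.newCode_succ, sweepStep, Cfg.newCell]
    rw [e]
    exact h'

theorem Machine.isHalting_cell {M : Machine} {c : Cfg M} {i : ℕ} :
    M.IsHalting (c.cell i) ↔ c.head = i ∧ M.step c = none := by
  rw [IsHalting, act_cell, step_eq_none]
  by_cases h : c.head = i <;> simp [Cfg.cell, h]

/-- A sweep simulates a step. -/
theorem Machine.feeds_of_step {M : Machine} {c c' : Cfg M} (h : M.step c = some c') {L : ℕ}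
    (hL : c.head < L) (hblank : ∀ i, L ≤ i → c.tape i = false) :
    Feeds M.sweepδ (M.sweepStart none) (c.code L ++ M.encode none) (M.sweepStart none)
      (c'.code (L + 1) ++ M.encode none) := by
  obtain ⟨L, rfl⟩ : ∃ k, L = k + 1 := ⟨L - 1, by omega⟩
  have hnh (j : ℕ) : ¬ M.IsHalting (c.cell j) := by simp [isHalting_cell, h]
  have h1 := feeds_cell c fun j (_ : j < L) => hnh j
  rw [afterCell, if_neg (hnh L)] at h1
  -- Beyond the coded part the cells are blank and without head, as the end-marker transition
  -- assumes.
  have hb (i : ℕ) (hi : L + 1 ≤ i) : c.cell i = M.blank := by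
    rw [Cfg.cell, hblank i hi, if_neg (by omega), blank]
  have hcode (k : ℕ) : c'.code k = c.newCode k := by
    simp only [Cfg.code, Cfg.newCode, cell_of_step h]
  have h2 := h1.append (M.feeds_encode _ none)
  have e : c'.code (L + 1 + 1) ++ M.encode none = c.newCode L ++
      (M.sweepStep (some (c.leftCell L, c.cell L)) none).2.flatMap M.encode := by
    rw [hcode, Cfg.newCode_succ, Cfg.newCode_succ, Cfg.newCell, Cfg.newCell, Cfg.leftCell,
      hb (L + 1) le_rfl, hb (L + 1 + 1) (by omega)]
    simp [sweepStep]
  rw [e]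
  exact h2

open Classical in
-- The sweep stops as soon as the cell with the head is read, and leaves the rest of the queue
-- unread.
theorem Machine.feeds_of_halts {M : Machine} {c : Cfg M} (h : M.step c = none) :
    Feeds M.sweepδ (M.sweepStart none) (c.code (c.head + 1))
      (done (decide (c.state ∈ M.accept))) (c.newCode c.head) := by
  have h1 := feeds_cell c (i := c.head) fun j hj => by rw [isHalting_cell]; omega
  rw [afterCell, if_pos (isHalting_cell.2 ⟨rfl, h⟩)] at h1
  simpa [Cfg.cell] using h1

theorem map_range_getD (l : List Bool) :
    (List.range (l.length + 1)).map (fun i => l.getD i false) = l ++ [false] := by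
  refine List.ext_getElem (by simp) fun i h1 h2 => ?_
  simp only [List.length_map, List.length_range] at h1
  rcases Nat.lt_succ_iff_lt_or_eq.1 h1 with h | rfl
  · simp [h]
  · simp

theorem length_flatMap_encodeBit (w : List Bool) :
    (w.flatMap encodeBit).length = 2 * w.length := by
  induction w with
  | nil => rfl
  | cons b w ih =>
    rw [List.flatMap_cons, List.length_append, ih, List.length_cons]
    cases b <;> simp [encodeBit] <;> omega

theorem Machine.feeds_load_false (M : Machine) (w : List Bool) :
    Feeds M.sweepδ (load false) w (load false)
      (((w.flatMap encodeBit).map fun a => some (a, none)).flatMap M.encode) := by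
  induction w with
  | nil => exact .nil _
  | cons b w ih =>
    rw [List.flatMap_cons, List.map_append, List.flatMap_append]
    refine .cons ?_ ih
    cases b <;> rfl

/-- The input is replaced by the code of the initial configuration. -/
theorem Machine.feeds_load (M : Machine) (w : List Bool) : ∃ f o o',
    Feeds M.sweepδ (load true) w (load f) o ∧
    M.sweepδ (load f) none = some (M.sweepStart none, o') ∧
    o ++ o' = (M.init w).code (2 * w.length + 1) ++ M.encode none := by
  cases w with
  | nil =>
    refine ⟨true, [], _, .nil _, rfl, ?_⟩
    simp [Cfg.code, Cfg.cell, init, inputTape]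
  | cons b w =>
    refine ⟨false, _, _, .cons rfl (M.feeds_load_false w), rfl, ?_⟩
    -- Cell `0` carries the head and is treated apart; the cells from `1` on hold the second half of
    -- the first letter, the code of `w`, and one blank.
    have hl := map_range_getD (b :: w.flatMap encodeBit)
    have hb : encodeBit b = [!b, b] := by cases b <;> rfl
    have hcell : (fun i => some ((M.init (b :: w)).cell (i + 1))) =
        (fun a : Bool => (some (a, none) : M.Letter)) ∘
          fun i => (b :: w.flatMap encodeBit).getD i false := by
      funext i
      simp [Cfg.cell, init, inputTape, hb]
    have hcell0 : (M.init (b :: w)).cell 0 = (!b, some M.start) := by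
      simp [Cfg.cell, init, inputTape, hb]
    have : (List.range (2 * (b :: w).length + 1)).map (fun i => some ((M.init (b :: w)).cell i)) =
        some (!b, some M.start) :: ((b :: w.flatMap encodeBit) ++ [false]).map
          (fun a : Bool => (some (a, none) : M.Letter)) := by
      rw [← hl, List.map_map, ← hcell, List.length_cons, List.length_cons,
        length_flatMap_encodeBit, show 2 * (w.length + 1) + 1 = 2 * w.length + 1 + 1 + 1 by ring,
        List.range_succ_eq_map, List.map_cons, hcell0, List.map_map]
      rfl
    rw [Cfg.code, this]
    simp

end WOTM

namespace WOTM
open QueueState SweepState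

/-! ### The write-once machine of a Turing machine -/

/-- The write-once machine that simulates `M`. -/
noncomputable def Machine.writeOnce (M : Machine) : Machine :=
  queueMachine (Nat.card M.Letter * 3) M.sweepδ (load true) {s | s = done true}

theorem Machine.head_le_of_run {M : Machine} {w : List Bool} {t : ℕ} {c : Cfg M}
    (h : M.run w t = some c) : c.head ≤ t := by
  induction t generalizing c with
  | zero =>
    rw [run, Option.some.injEq] at h
    rw [← h, init]
  | succ t ih =>
    obtain ⟨d, hd, hc⟩ := run_succ_eq_some h
    obtain ⟨⟨q, b, m⟩, -, rfl⟩ := step_eq_some hc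
    have := ih hd
    cases m <;> simp only [Move.apply] <;> omega

theorem Machine.tape_eq_false_of_run {M : Machine} {w : List Bool} {t : ℕ} {c : Cfg M}
    (h : M.run w t = some c) {i : ℕ} (hi : 2 * w.length + t ≤ i) : c.tape i = false := by
  induction t generalizing c with
  | zero =>
    rw [run, Option.some.injEq] at h
    rw [← h]
    exact List.getD_eq_default _ _ (by rw [length_flatMap_encodeBit]; exact hi)
  | succ t ih =>
    obtain ⟨d, hd, hc⟩ := run_succ_eq_some h
    obtain ⟨r, -, rfl⟩ := step_eq_some hc
    have := head_le_of_run hd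
    exact (Function.update_of_ne (by omega) _ _).trans (ih hd (by omega))

/-- A bound on the number of letters that have been written when `t` steps on an input of length
`n` have been simulated, where `N` is the maximal length of the code of a cell. -/
def queueBound (N n t : ℕ) : ℕ :=
  n + 1 + (t + 1) * (N * (2 * n + t + 2))

/-- The added term bounds the output of one more sweep: `2 * n + 1 + (t + 1)` cells and the end
marker, with at most `N` bits each. -/
theorem queueBound_succ (N n t : ℕ) :
    queueBound N n t + N * (2 * n + t + 3) ≤ queueBound N n (t + 1) := by
  have h : (t + 1) * (N * (2 * n + t + 2)) ≤ (t + 1) * (N * (2 * n + t + 3)) := by gcongr; omega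
  have e : (t + 1 + 1) * (N * (2 * n + (t + 1) + 2)) =
      (t + 1) * (N * (2 * n + t + 3)) + N * (2 * n + t + 3) := by ring
  rw [queueBound, queueBound, e]
  omega

theorem Cfg.length_code_append_le {M : Machine} (c : Cfg M) (L : ℕ) :
    (c.code L ++ M.encode none).length ≤ Nat.card M.Letter * (L + 1) := by
  have h1 := c.length_code_le L
  have h2 := M.length_encode_le none
  rw [List.length_append, mul_add_one]
  omega

/-- The invariant of the simulation: after `t` sweeps the tape holds `e` erased pairs, followed by
the code of the configuration. One cell is added per sweep, so the head of `M`, which is at most at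
`t`, never leaves the coded part. -/
theorem Machine.reach_of_run (M : Machine) (w : List Bool) (t : ℕ) {c : Cfg M}
    (h : M.run w t = some c) {S : ℕ} (hS : 2 * queueBound (Nat.card M.Letter) w.length t + 1 < S) :
    ∃ e, e + (c.code (2 * w.length + 1 + t) ++ M.encode none).length ≤
        queueBound (Nat.card M.Letter) w.length t ∧
      M.writeOnce.Reach S (M.writeOnce.init w)
        (pairCfg M.sweepδ (load true) {s | s = done true} (fetch (M.sweepStart none) true)
          (List.replicate e (true, true))
          ((c.code (2 * w.length + 1 + t) ++ M.encode none).map letter)) := by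
  have hB : ∀ q o q' w, M.sweepδ q o = some (q', w) → w.length ≤ Nat.card M.Letter * 3 :=
    fun _ _ _ _ => length_le_of_sweepδ
  induction t generalizing c with
  | zero =>
    rw [run, Option.some.injEq] at h
    subst h
    obtain ⟨f, o, o', h1, h2, h3⟩ := M.feeds_load w
    have hlen := (M.init w).length_code_append_le (2 * w.length + 1)
    have hoo := congrArg List.length h3
    rw [List.length_append] at hoo
    have hb : queueBound (Nat.card M.Letter) w.length 0 =
      w.length + 1 + Nat.card M.Letter * (2 * w.length + 1 + 1) := by rw [queueBound]; ring
    rw [hb] at hS ⊢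
    -- Loading erases the pairs of the input and the gap.
    refine ⟨w.length + 1, by rw [add_zero]; omega, ?_⟩
    have r1 := reach_of_feeds (start := load true) (accept := {s | s = done true}) (p := false)
      hB h1 (R := [(false, false)]) ⟨[], [], rfl⟩ 0 (S := S) (by simp; omega)
    have r2 := reach_queue_step (start := load true) (accept := {s | s = done true}) (p := false)
      (x := (false, false)) rfl h2 (hB _ _ _ _ h2) (R := o.map letter) ⟨o, rfl⟩ w.length (S := S)
      (by simp; omega)
    rw [← List.map_append, h3] at r2
    rw [pairCfg_append_blank, zero_add] at r1
    have hinit : M.writeOnce.init w = pairCfg M.sweepδ (load true) {s | s = done true}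
        (fetch (load true) false) (List.replicate 0 (true, true)) (w.map letter) := by
      rw [init, pairCfg, inputTape_eq_tapeOf]
      rfl
    rw [hinit]
    exact r1.trans r2
  | succ t ih =>
    obtain ⟨d, hd, hc⟩ := run_succ_eq_some h
    have hb := queueBound_succ (Nat.card M.Letter) w.length t
    obtain ⟨e, he, r⟩ := ih hd (by omega)
    have hhead := head_le_of_run hd
    have hf := feeds_of_step hc (L := 2 * w.length + 1 + t) (by omega)
      fun i hi => tape_eq_false_of_run hd (by omega)
    have hlen := c.length_code_append_le (2 * w.length + 1 + t + 1)
    rw [show 2 * w.length + 1 + t + 1 + 1 = 2 * w.length + t + 3 by ring] at hlen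
    have r1 := reach_of_feeds (start := load true) (accept := {s | s = done true}) (p := true)
      hB hf (R := []) ⟨[], rfl⟩ e (S := S) (by simp only [List.length_nil]; omega)
    rw [List.append_nil, List.nil_append] at r1
    refine ⟨_, ?_, r.trans r1⟩
    rw [show 2 * w.length + 1 + (t + 1) = 2 * w.length + 1 + t + 1 by ring]
    omega

/-- One more, partial sweep leads to `done`, whence `t + 1` in the bound. As `done` has no
transition, the write-once machine gets stuck on the second cell of the next pair, in a state
`fetchSnd`. -/
theorem Machine.reach_of_halts {M : Machine} {w : List Bool} {t : ℕ} {c : Cfg M}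
    (h : M.run w t = some c) (hc : M.step c = none) {S : ℕ}
    (hS : 2 * queueBound (Nat.card M.Letter) w.length (t + 1) + 1 < S) :
    ∃ d, M.writeOnce.Reach S (M.writeOnce.init w) d ∧ d.head < S ∧ M.writeOnce.step d = none ∧
      (d.state ∈ M.writeOnce.accept ↔ c.state ∈ M.accept) := by
  classical
  have hb := queueBound_succ (Nat.card M.Letter) w.length t
  obtain ⟨e, he, r⟩ := M.reach_of_run w t h (S := S) (by omega)
  have hhead := head_le_of_run h
  obtain ⟨v, hv⟩ := c.code_add (c.head + 1) (2 * w.length + t - c.head)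
  rw [show c.head + 1 + (2 * w.length + t - c.head) = 2 * w.length + 1 + t by omega] at hv
  have hn := c.length_newCode_le c.head
  have hn' : Nat.card M.Letter * c.head ≤ Nat.card M.Letter * (2 * w.length + t + 3) :=
    Nat.mul_le_mul_left _ (by omega)
  rw [hv] at he r
  simp only [List.length_append] at he
  have r1 := reach_of_feeds (B := Nat.card M.Letter * 3) (start := load true)
    (accept := {s | s = done true}) (p := true) (fun _ _ _ _ => length_le_of_sweepδ)
    (feeds_of_halts hc) (R := (v ++ M.encode none).map letter) ⟨_, rfl⟩ e (S := S)
    (by simp only [List.length_map, List.length_append]; omega)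
  rw [List.append_assoc, List.map_append] at r
  -- What remains on the queue is irrelevant, since `done` halts on every letter.
  generalize (v ++ M.encode none).map letter ++ _ = R at r1
  generalize hL : List.replicate (e + (c.code (c.head + 1)).length) (true, true) = L at r1
  have hL' : L.length = e + (c.code (c.head + 1)).length := by rw [← hL, List.length_replicate]
  refine ⟨⟨fetchSnd (done (decide (c.state ∈ M.accept))) true (tapeOf (L ++ R) (2 * L.length)),
    2 * L.length + 1, Function.update (tapeOf (L ++ R)) (2 * L.length) true⟩,
    (r.trans r1).trans (.head ?_ rfl .refl), ?_, ?_, ?_⟩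
  · simp only [pairCfg]; omega
  · change 2 * L.length + 1 < S
    omega
  · rw [step_eq_none]
    change queueδ (Nat.card M.Letter * 3) M.sweepδ (fetchSnd _ _ _) _ = none
    simp only [queueδ, sweepδ, Option.map_none]
    exact Option.bind_fun_none _
  · change (∃ q ∈ {s | s = done true}, ∃ p a, _ = fetchSnd q p a) ↔ _
    simp

theorem queueBound_le (N n t : ℕ) :
    2 * queueBound N n (t + 1) + 2 ≤ (36 * N + 6) * (n + t + 1) ^ 2 := by
  have h : (t + 1 + 1) * (N * (2 * n + (t + 1) + 2)) ≤
      (2 * (n + t + 1)) * (N * (3 * (n + t + 1))) := by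
    gcongr <;> omega
  rw [queueBound]
  nlinarith [Nat.zero_le (N * (n + t + 1) ^ 2), sq_nonneg (n + t), Nat.zero_le (n + t)]

theorem kExpTime_subset_kDExpWOSpace (k : ℕ) : kExpTime k ⊆ kDExpWOSpace k := by
  intro L hL
  obtain ⟨t, M, C, hL, hT⟩ := Set.mem_iUnion.1 hL
  set N := Nat.card M.Letter
  set A := C * (kexp k 1 + 1) + C + 1 with hA
  -- The exponent `t + 1` in place of `t` gives `n ≤ kexp k (n ^ (t + 1))` also for `t = 0`, so that
  -- the input length is absorbed.
  obtain ⟨C', hC'⟩ := exists_quadratic_kexp_le k (t + 1) ((36 * N + 6) * (A ^ 2 * 2))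
    ((36 * N + 6) * (A ^ 2 * 2))
  have hbound (n : ℕ) : 2 * queueBound N n ((C * kexp k (n ^ t) + C) + 1) + 2 ≤
      C' * kexp k (n ^ (2 * (t + 1) + 1)) + C' := by
    refine (queueBound_le _ _ _).trans (le_trans ?_ (hC' n))
    have h1 : n ≤ kexp k (n ^ (t + 1)) :=
      (Nat.le_self_pow (Nat.succ_ne_zero t) n).trans (le_kexp k _)
    -- The summand `kexp k 1` is for `n = 0`, where `n ^ t` is `1` if `t = 0`.
    have h2 : kexp k (n ^ t) ≤ kexp k (n ^ (t + 1)) + kexp k 1 := by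
      rcases n.eq_zero_or_pos with rfl | hn
      · exact le_add_left (kexp_mono k (pow_le_one₀ le_rfl zero_le_one))
      · exact le_add_right (kexp_mono k (Nat.pow_le_pow_right hn (Nat.le_succ t)))
    generalize kexp k (n ^ (t + 1)) = E at *
    have h3 : n + (C * kexp k (n ^ t) + C) + 1 ≤ A * (E + 1) := by
      have := Nat.mul_le_mul_left C h2
      rw [hA]
      nlinarith [Nat.zero_le (C * kexp k 1 * E), Nat.zero_le (C * E)]
    calc (36 * N + 6) * (n + (C * kexp k (n ^ t) + C) + 1) ^ 2
        ≤ (36 * N + 6) * (A * (E + 1)) ^ 2 := by gcongr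
      _ = (36 * N + 6) * A ^ 2 * (E + 1) ^ 2 := by ring
      _ ≤ (36 * N + 6) * A ^ 2 * (2 * (E ^ 2 + 1)) := by
        refine Nat.mul_le_mul_left _ ?_
        zify
        nlinarith [sq_nonneg ((E : ℤ) - 1)]
      _ = _ := by ring
  have key (w : List Bool) : ∃ d s, M.writeOnce.run w s = some d ∧ M.writeOnce.step d = none ∧
      (d.state ∈ M.writeOnce.accept ↔ w ∈ L) ∧ ∀ s' d', M.writeOnce.run w s' = some d' →
        d'.head < C' * kexp k (w.length ^ (2 * (t + 1) + 1)) + C' := by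
    obtain ⟨T, c, hc, hh, hacc⟩ := hL w
    have hmono : queueBound N w.length (T + 1) ≤
        queueBound N w.length ((C * kexp k (w.length ^ t) + C) + 1) := by
      have := hT w T c hc
      unfold queueBound
      gcongr
    have hlt : 2 * queueBound N w.length (T + 1) + 1 <
        C' * kexp k (w.length ^ (2 * (t + 1) + 1)) + C' := by
      have := hbound w.length
      omega
    obtain ⟨d, hr, hd, hd', hda⟩ := Machine.reach_of_halts hc hh hlt
    obtain ⟨s, hs, hlt'⟩ := hr.exists_run
    refine ⟨d, s, hs, hd', hda.trans hacc, fun s' d' h => ?_⟩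
    -- `Machine.Reach` bounds the head only before the last configuration, so the halting one is
    -- treated apart.
    rcases (Machine.run_le_of_halts hs hd' h).lt_or_eq with hlt | rfl
    · exact hlt' s' d' hlt h
    · rw [hs, Option.some.injEq] at h
      exact h ▸ hd
  refine Set.mem_iUnion.2 ⟨2 * (t + 1) + 1, M.writeOnce, C', queueMachine_isWriteOnce, ?_, ?_⟩
  · intro w
    obtain ⟨d, s, h1, h2, h3, -⟩ := key w
    exact ⟨s, d, h1, h2, h3⟩
  · intro w s d h
    obtain ⟨-, -, -, -, -, h4⟩ := key w
    exact h4 s d h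

end WOTM

theorem theorem2 (k : ℕ) : WOTM.kExpTime k = WOTM.kDExpWOSpace k :=
  Set.Subset.antisymm (WOTM.kExpTime_subset_kDExpWOSpace k) (WOTM.kDExpWOSpace_subset_kExpTime k)
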